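/- Let $\mathcal X\subset\mathbb R^n$ and let $P,\tilde P$ be (Borel) probability measures on $\mathcal X$. For finite measures put $D(\nu\,\|\,\mu)=\int\log\frac{d\nu}{d\mu}\,d\nu+\mu(\cdot)-\nu(\cdot)$ (total masses; $D=+\infty$ if $\nu\not\ll\mu$), the Kullback–Leibler divergence. For a cost $d:\mathcal X\times\mathcal X\to[0,\infty)$, parameters $\eta=(\eta_1,\eta_2)$ with $\eta_1,\eta_2>0$, and $\lambda>0$, let $$\mathrm{UOT}_{1;\eta}(\mu,\nu)=\inf_{\pi}\ \iint d\,d\pi+\eta_1D(\tau_{1\#}\pi\,\|\,\mu)+\eta_2D(\tau_{2\#}\pi\,\|\,\nu),$$ $$\mathrm{UOT}_{1;\eta;\lambda}(\mu,\nu)=\inf_{\pi}\ \iint d\,d\pi+\tfrac1\lambda D(\pi\,\|\,\mu\otimes\nu)+\eta_1D(\tau_{1\#}\pi\,\|\,\mu)+\eta_2D(\tau_{2\#}\pi\,\|\,\nu),$$ the infima being over all finite non-negative measures $\pi$ on $\mathcal X\times\mathcal X$, with marginals $\tau_{1\#}\pi,\tau_{2\#}\pi$, and let $$\mathrm{sd}_{1;\eta;\lambda}(\mu,\nu)=\mathrm{UOT}_{1;\eta;\lambda}(\mu,\nu)-\tfrac12\mathrm{UOT}_{1;\eta;\lambda}(\mu,\mu)-\tfrac12\mathrm{UOT}_{1;\eta;\lambda}(\nu,\nu)+\tfrac1{2\lambda}\bigl(\mu(\mathcal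 X)-\nu(\mathcal X)\bigr)^2 .$$ (i) If $d$ is continuous with $d(x,x)=0$ for all $x$ (for example $d(x,y)=\|x-y\|$), then for all $\eta_1,\eta_2>0$ $$\lim_{\lambda\to\infty}\mathrm{sd}_{1;\eta;\lambda}(P,\tilde P)=\mathrm{UOT}_{1;\eta}(P,\tilde P).$$ (ii) Let $d(x,y)=\|x-y\|$ be the Euclidean distance, and let $P$ and $\tilde P$ have finite first moments. Then for each $\lambda>0$ the limit of $\mathrm{sd}_{1;\eta;\lambda}(P,\tilde P)$ as $\eta_1,\eta_2\to\infty$ exists in $\mathbb R$, and $$\lim_{\lambda\to0}\ \lim_{\eta\to\infty}\mathrm{sd}_{1;\eta;\lambda}(P,\tilde P)=\tfrac12\,\mathrm{MMD}_{k^e}(P,\tilde P)^2 ,$$ where $k^e(x,y)=-\|x-y\|$ is the energy kernel and $$\mathrm{MMD}_{k}(P,\tilde P)=\Bigl(\iint k\,dP\,dP-2\iint k\,dP\,d\tilde P+\iint k\,d\tilde P\,d\tilde P\Bigr)^{1/2};$$ that is, the limit is the energy distance in the normalization $\mathbb E\|X-Y\|-\frac12\mathbb E\|X-X'\|-\frac12\mathbb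 E\|Y-Y'\|$ with $X,X'\sim P$ and $Y,Y'\sim\tilde P$ independent. -/

import Mathlib

open MeasureTheory Filter Topology
open scoped ENNReal

noncomputable section

namespace UnbalancedOT

variable {α : Type*} [MeasurableSpace α]

/-- The transport cost `⟨π | d⟩ = ∬ d(x, y) π(dx, dy)` of a plan, for a non-negative cost `d`. -/
def transportCost (d : α → α → ℝ) (π : Measure (α × α)) : ℝ≥0∞ :=
  ∫⁻ p, ENNReal.ofReal (d p.1 p.2) ∂π

/-- The unbalanced optimal transport cost of order `1` with marginal parameters `η₁, η₂`: the
infimum over all finite non-negative measures `π` on the product of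
`⟨π | d⟩ + η₁ D(τ₁#π ‖ μ) + η₂ D(τ₂#π ‖ ν)`.
Here `InformationTheory.klDiv` is the Kullback-Leibler (Bregman) divergence
`D(ν ‖ μ) = ∫ log(dν/dμ) dν + μ(X) - ν(X)` of finite measures, and `∞` if `ν` is not absolutely
continuous or if the integral diverges. For finite `μ, ν` the value is finite (try `π = 0`). -/
def uot (d : α → α → ℝ) (η₁ η₂ : ℝ) (μ ν : Measure α) : ℝ≥0∞ :=
  ⨅ (π : Measure (α × α)) (_ : IsFiniteMeasure π),
    transportCost d π
      + ENNReal.ofReal η₁ * InformationTheory.klDiv (π.map Prod.fst) μ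
      + ENNReal.ofReal η₂ * InformationTheory.klDiv (π.map Prod.snd) ν

/-- The entropy regularized unbalanced optimal transport cost of order `1`: the objective of `uot`
with the additional term `(1 / lam) D(π ‖ μ ⊗ ν)`. Again finite for finite `μ, ν`. -/
def uotReg (d : α → α → ℝ) (η₁ η₂ lam : ℝ) (μ ν : Measure α) : ℝ≥0∞ :=
  ⨅ (π : Measure (α × α)) (_ : IsFiniteMeasure π),
    transportCost d π
      + ENNReal.ofReal (1 / lam) * InformationTheory.klDiv π (μ.prod ν)
      + ENNReal.ofReal η₁ * InformationTheory.klDiv (π.map Prod.fst) μ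
      + ENNReal.ofReal η₂ * InformationTheory.klDiv (π.map Prod.snd) ν

/-- The debiased regularized unbalanced optimal transport cost (Sinkhorn divergence). -/
def sinkhornDiv (d : α → α → ℝ) (η₁ η₂ lam : ℝ) (μ ν : Measure α) : ℝ :=
  (uotReg d η₁ η₂ lam μ ν).toReal
    - 1 / 2 * (uotReg d η₁ η₂ lam μ μ).toReal
    - 1 / 2 * (uotReg d η₁ η₂ lam ν ν).toReal
    + 1 / (2 * lam) * (μ.real Set.univ - ν.real Set.univ) ^ 2

/-- The maximum mean discrepancy for a kernel `k`: the (semi)norm of `μ - ν` induced by `k`, i.e.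
`MMD_k(μ, ν)² = ∬ k dμ dμ - 2 ∬ k dμ dν + ∬ k dν dν`. This expansion of the norm also applies to
kernels such as the energy kernel that are only conditionally positive definite, where no
reproducing kernel Hilbert space with kernel `k` itself exists. -/
def mmd (k : α → α → ℝ) (μ ν : Measure α) : ℝ :=
  Real.sqrt ((∫ x, ∫ y, k x y ∂μ ∂μ) - 2 * (∫ x, ∫ y, k x y ∂ν ∂μ) + ∫ x, ∫ y, k x y ∂ν ∂ν)

/-- The Euclidean distance on a subset of `ℝⁿ`. -/
def euclideanCost {n : ℕ} {X : Set (EuclideanSpace ℝ (Fin n))} (x y : X) : ℝ :=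
  ‖(x : EuclideanSpace ℝ (Fin n)) - (y : EuclideanSpace ℝ (Fin n))‖

/-- The energy kernel `kᵉ(x, y) = -‖x - y‖`. -/
def energyKernel {n : ℕ} {X : Set (EuclideanSpace ℝ (Fin n))} (x y : X) : ℝ :=
  -‖(x : EuclideanSpace ℝ (Fin n)) - (y : EuclideanSpace ℝ (Fin n))‖

end UnbalancedOT

end

/-!
Debiased unbalanced transport interpolates between unbalanced transport and the energy distance.

When the entropic penalty vanishes, the regularized cost tends to the unregularized one
(`tendsto_uotReg_atTop`). One inequality is trivial; for the other, a nearly optimal plan has to be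
approximated by plans of finite entropy (`exists_finite_klDiv_approx`). Cut the plan into pieces
that live in small open boxes, keep finitely many, and replace each by the product of its marginals
(`exists_product_replacement`). By continuity of the cost this hardly changes the transport cost,
and it only removes a small part of each marginal, which raises the marginal divergences by little
(`klDiv_le_klDiv_add`). The two debiasing terms tend to the unregularized cost between a measure and
itself, which vanishes because of the diagonal coupling (`uot_self`).

When the entropic penalty dominates, the plan is forced to be the independent coupling. Its cost is
an upper bound for all values of the marginal parameters. Young's inequality for the entropy gives
the lower bound `∫ (1 - exp (-lam * d)) / lam` with respect to the product measure, again for all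
marginal parameters (`lintegral_le_uotReg`), and it tends to the same value as `lam → 0`. The limit
over the marginal parameters exists by monotonicity and is squeezed between the two
(`tendsto_iSup_uotReg`).

The resulting combination of mean distances is half the squared discrepancy for the energy kernel,
provided that it is nonnegative (`lintegral_norm_sub_le`). The Euclidean norm is, up to a constant,
the mean absolute value of a projection onto a Gaussian direction, and `|a - b|` is the length of
the set of thresholds separating `a` and `b`; this reduces the inequality to indicators of sets,
where the defect is a square.
-/

namespace UnbalancedOT

open InformationTheory ProbabilityTheory

/-! ### Inequalities for the Kullback-Leibler divergence -/

variable {α : Type*} [MeasurableSpace α]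

lemma klFun_add_klFun_le {a b : ℝ} (ha : 0 ≤ a) (hb : 0 ≤ b) :
    klFun a + klFun b ≤ klFun (a + b) + 1 := by
  have key : ∀ {s t : ℝ}, 0 ≤ s → 0 ≤ t → s * Real.log s ≤ s * Real.log (s + t) := by
    intro s t hs ht
    rcases hs.eq_or_lt with rfl | hs
    · simp
    · exact mul_le_mul_of_nonneg_left (Real.log_le_log hs (by linarith)) hs.le
  have h1 := key ha hb
  have h2 := key hb ha
  rw [add_comm b a] at h2
  simp only [klFun_apply]
  linarith

/-- Young's inequality for `klFun`, whose convex conjugate is `t ↦ exp t - 1`. -/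
lemma one_sub_exp_neg_le {r s : ℝ} (hr : 0 ≤ r) : 1 - Real.exp (-s) ≤ r * s + klFun r := by
  rcases hr.eq_or_lt with rfl | hr
  · simp [klFun_zero, (Real.exp_pos (-s)).le]
  · have h := Real.add_one_le_exp (-(Real.log r + s))
    have h2 : Real.exp (-s) = r * Real.exp (-(Real.log r + s)) := by
      rw [neg_add, Real.exp_add, Real.exp_neg (Real.log r), Real.exp_log hr, ← mul_assoc,
        mul_inv_cancel₀ hr.ne', one_mul]
    rw [h2, klFun_apply]
    nlinarith [mul_le_mul_of_nonneg_left h hr.le]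

/-- Superadditivity of the divergence in its first argument, up to the mass of the
reference measure. -/
lemma klDiv_add_klDiv_le (ν ρ μ : Measure α) [IsFiniteMeasure ν] [IsFiniteMeasure ρ]
    [IsFiniteMeasure μ] :
    klDiv ν μ + klDiv ρ μ ≤ klDiv (ν + ρ) μ + μ Set.univ := by
  by_cases h : ν + ρ ≪ μ
  · have hν : ν ≪ μ := (Measure.le_add_right le_rfl).absolutelyContinuous.trans h
    have hρ : ρ ≪ μ := (Measure.le_add_left le_rfl).absolutelyContinuous.trans h
    have hm : ∀ κ : Measure α, Measurable fun x ↦ ENNReal.ofReal (klFun (κ.rnDeriv μ x).toReal) :=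
      fun κ ↦ (measurable_klFun.comp (Measure.measurable_rnDeriv κ μ).ennreal_toReal).ennreal_ofReal
    rw [klDiv_eq_lintegral_klFun_of_ac h, klDiv_eq_lintegral_klFun_of_ac hν,
      klDiv_eq_lintegral_klFun_of_ac hρ, ← lintegral_add_left (hm ν), ← lintegral_one,
      ← lintegral_add_left (hm _)]
    refine lintegral_mono_ae ?_
    filter_upwards [Measure.rnDeriv_add' ν ρ μ, Measure.rnDeriv_lt_top ν μ,
      Measure.rnDeriv_lt_top ρ μ] with x hx h1 h2
    rw [hx, Pi.add_apply, ENNReal.toReal_add h1.ne h2.ne, ← ENNReal.ofReal_one,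
      ← ENNReal.ofReal_add (klFun_nonneg ENNReal.toReal_nonneg)
        (klFun_nonneg ENNReal.toReal_nonneg),
      ← ENNReal.ofReal_add (klFun_nonneg (add_nonneg ENNReal.toReal_nonneg ENNReal.toReal_nonneg))
        zero_le_one]
    exact ENNReal.ofReal_le_ofReal
      (klFun_add_klFun_le ENNReal.toReal_nonneg ENNReal.toReal_nonneg)
  · simp [klDiv_of_not_ac h]

/-- Removing a part `ρ` of small mass from a measure raises its divergence by a small amount only:
the error term tends to `0` with the mass of `ρ`, since `klFun 0 = 1`. -/
lemma klDiv_le_klDiv_add (ν ρ μ : Measure α) [IsFiniteMeasure ν] [IsFiniteMeasure ρ]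
    [IsProbabilityMeasure μ] :
    klDiv ν μ ≤ klDiv (ν + ρ) μ + ENNReal.ofReal (1 - klFun (ρ.real Set.univ)) := by
  have h1 := klDiv_add_klDiv_le ν ρ μ
  have h2 : ENNReal.ofReal (klFun (ρ.real Set.univ)) ≤ klDiv ρ μ := by
    by_cases h : klDiv ρ μ = ∞
    · simp [h]
    · obtain ⟨hac, hint⟩ := klDiv_ne_top_iff.1 h
      have := mul_klFun_le_toReal_klDiv hac hint
      simp only [probReal_univ, one_mul, div_one] at this
      exact ENNReal.ofReal_le_of_le_toReal this
  refine (ENNReal.add_le_add_iff_right (a := ENNReal.ofReal (klFun (ρ.real Set.univ)))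
    ENNReal.ofReal_ne_top).1 ?_
  calc _ ≤ klDiv ν μ + klDiv ρ μ := by gcongr
    _ ≤ klDiv (ν + ρ) μ + μ Set.univ := h1
    _ ≤ _ := by
      rw [add_assoc, measure_univ]
      gcongr
      rw [← ENNReal.ofReal_one]
      refine le_trans (le_of_eq ?_) ENNReal.ofReal_add_le
      ring_nf

lemma klDiv_ne_top_of_le_smul {ν μ : Measure α} [IsFiniteMeasure ν] [IsFiniteMeasure μ]
    {C : ℝ≥0∞} (hC : C ≠ ∞) (h : ν ≤ C • μ) : klDiv ν μ ≠ ∞ := by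
  have hac : ν ≪ μ := (Measure.absolutelyContinuous_of_le h).trans
    (Measure.AbsolutelyContinuous.smul_left Measure.AbsolutelyContinuous.rfl C)
  have hle : ∀ᵐ x ∂μ, ν.rnDeriv μ x ≤ C := by
    refine ae_le_of_forall_setLIntegral_le_of_sigmaFinite (Measure.measurable_rnDeriv ν μ) ?_
    intro s _ _
    calc _ ≤ ν s := Measure.setLIntegral_rnDeriv_le s
      _ ≤ (C • μ) s := h s
      _ = _ := by simp
  rw [klDiv_eq_lintegral_klFun_of_ac hac]
  refine ne_top_of_le_ne_top (b := ∫⁻ _, ENNReal.ofReal (1 + C.toReal ^ 2) ∂μ)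
    (by simp [ENNReal.mul_eq_top]) ?_
  refine lintegral_mono_ae ?_
  filter_upwards [hle] with x hx
  refine ENNReal.ofReal_le_ofReal ?_
  have hx' := ENNReal.toReal_mono hC hx
  have hr : 0 ≤ (ν.rnDeriv μ x).toReal := ENNReal.toReal_nonneg
  generalize (ν.rnDeriv μ x).toReal = r at hx' hr ⊢
  rw [klFun_apply]
  rcases hr.eq_or_lt with rfl | hr
  · simp
  -- `log r ≤ r - 1` gives `klFun r ≤ (r - 1) ^ 2`
  · nlinarith [mul_le_mul_of_nonneg_left (Real.log_le_sub_one_of_pos hr) hr.le]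

/-- Weak duality for entropically penalized costs: a lower bound that holds for every plan `π`,
without any constraint on its total mass or its marginals. -/
lemma lintegral_one_sub_exp_le {c : α → ℝ} (hc : Measurable c) (hc0 : ∀ x, 0 ≤ c x)
    {lam : ℝ} (hlam : 0 < lam) (π μ : Measure α) [IsFiniteMeasure π] [IsFiniteMeasure μ] :
    ∫⁻ x, ENNReal.ofReal ((1 - Real.exp (-(lam * c x))) / lam) ∂μ ≤
      ∫⁻ x, ENNReal.ofReal (c x) ∂π + ENNReal.ofReal (1 / lam) * klDiv π μ := by
  by_cases h : π ≪ μ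
  · have hm : Measurable fun x ↦ ENNReal.ofReal (klFun (π.rnDeriv μ x).toReal) :=
      (measurable_klFun.comp (Measure.measurable_rnDeriv π μ).ennreal_toReal).ennreal_ofReal
    rw [klDiv_eq_lintegral_klFun_of_ac h, ← lintegral_rnDeriv_mul h hc.ennreal_ofReal.aemeasurable,
      ← lintegral_const_mul _ hm, ← lintegral_add_right _ (hm.const_mul _)]
    refine lintegral_mono_ae ?_
    filter_upwards [Measure.rnDeriv_lt_top π μ] with x hx
    rw [← ENNReal.ofReal_toReal hx.ne, ENNReal.toReal_ofReal ENNReal.toReal_nonneg,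
      ← ENNReal.ofReal_mul ENNReal.toReal_nonneg, ← ENNReal.ofReal_mul (by positivity),
      ← ENNReal.ofReal_add (mul_nonneg ENNReal.toReal_nonneg (hc0 x))
        (mul_nonneg (by positivity) (klFun_nonneg ENNReal.toReal_nonneg))]
    refine ENNReal.ofReal_le_ofReal ?_
    have := one_sub_exp_neg_le (r := (π.rnDeriv μ x).toReal) (s := lam * c x)
      ENNReal.toReal_nonneg
    rw [div_le_iff₀ hlam]
    refine this.trans (le_of_eq ?_)
    field_simp
  · rw [klDiv_of_not_ac h, ENNReal.mul_top (by simpa using hlam)]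
    simp

lemma tendsto_lintegral_one_sub_exp {c : α → ℝ} (hc : Measurable c) (μ : Measure α)
    (hfin : ∫⁻ x, ENNReal.ofReal (c x) ∂μ ≠ ∞) :
    Tendsto (fun lam : ℝ ↦ ∫⁻ x, ENNReal.ofReal ((1 - Real.exp (-(lam * c x))) / lam) ∂μ) (𝓝[>] 0)
      (𝓝 (∫⁻ x, ENNReal.ofReal (c x) ∂μ)) := by
  refine tendsto_lintegral_filter_of_dominated_convergence (fun x ↦ ENNReal.ofReal (c x))
    (.of_forall fun lam ↦ by fun_prop) ?_ hfin (.of_forall fun x ↦ ?_)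
  · filter_upwards [self_mem_nhdsWithin] with lam hlam
    refine .of_forall fun x ↦ ENNReal.ofReal_le_ofReal ?_
    rw [div_le_iff₀ hlam]
    linarith [Real.add_one_le_exp (-(lam * c x)), mul_comm lam (c x)]
  · refine (ENNReal.continuous_ofReal.tendsto _).comp ?_
    have hd : HasDerivAt (fun lam : ℝ ↦ 1 - Real.exp (-(lam * c x))) (c x) 0 := by
      have := (((hasDerivAt_id (0 : ℝ)).mul_const (c x)).neg.exp).const_sub 1
      simpa using this
    have := hd.tendsto_slope_zero_right
    refine this.congr fun t ↦ ?_
    simp [div_eq_inv_mul]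

/-! ### Vanishing entropic penalty -/

lemma prod_le_smul_prod {α β : Type*} [MeasurableSpace α] [MeasurableSpace β]
    {κ₁ μ : Measure α} {κ₂ ν : Measure β} [SFinite κ₂] [SFinite ν] {C : ℝ≥0∞}
    (h₁ : κ₁ ≤ C • μ) (h₂ : κ₂ ≤ C • ν) : κ₁.prod κ₂ ≤ (C * C) • μ.prod ν := by
  refine Measure.le_iff.2 fun s hs ↦ ?_
  rw [Measure.smul_apply, Measure.prod_apply hs, Measure.prod_apply hs, smul_eq_mul, mul_assoc]
  calc ∫⁻ x, κ₂ (Prod.mk x ⁻¹' s) ∂κ₁ ≤ ∫⁻ x, C * ν (Prod.mk x ⁻¹' s) ∂(C • μ) :=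
        lintegral_mono' h₁ fun x ↦ by simpa using h₂ (Prod.mk x ⁻¹' s)
    _ = _ := by
      rw [lintegral_smul_measure, smul_eq_mul,
        lintegral_const_mul _ (measurable_measure_prodMk_left hs)]

/-- A plan `κ` carried by a box on which `c` oscillates by at most `δ` can be replaced by the
normalized product of its marginals: the marginals stay the same, the cost grows by at most `δ` per
unit of mass, and the new plan has a bounded density with respect to `μ.prod ν` if the marginals
of `κ` have bounded densities. -/
lemma exists_product_replacement {κ : Measure (α × α)} [IsFiniteMeasure κ] {μ ν : Measure α}
    [SFinite ν] {A B : Set α} (hA : MeasurableSet A) (hB : MeasurableSet B)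
    (hκ : ∀ᵐ p ∂κ, p ∈ A ×ˢ B) {c : α × α → ℝ≥0∞} (hc : Measurable c) {δ : ℝ≥0∞}
    (hosc : ∀ p ∈ A ×ˢ B, ∀ q ∈ A ×ˢ B, c p ≤ c q + δ) {C : ℝ≥0∞} (hC : C ≠ ∞)
    (h₁ : κ.map Prod.fst ≤ C • μ) (h₂ : κ.map Prod.snd ≤ C • ν) :
    ∃ κ' : Measure (α × α), IsFiniteMeasure κ' ∧ κ'.map Prod.fst = κ.map Prod.fst ∧
      κ'.map Prod.snd = κ.map Prod.snd ∧ (∃ C' : ℝ≥0∞, C' ≠ ∞ ∧ κ' ≤ C' • μ.prod ν) ∧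
      ∫⁻ p, c p ∂κ' ≤ ∫⁻ p, c p ∂κ + δ * κ Set.univ := by
  rcases eq_or_ne κ 0 with rfl | hne
  · exact ⟨0, inferInstance, rfl, rfl, ⟨0, by simp, by simp⟩, by simp⟩
  set m := κ Set.univ with hm
  have hm0 : m ≠ 0 := by simpa [hm] using hne
  have hmt : m ≠ ∞ := measure_ne_top _ _
  have hmi : m⁻¹ ≠ ∞ := ENNReal.inv_ne_top.2 hm0
  have e1 : κ.map Prod.fst Set.univ = m := by rw [Measure.map_apply measurable_fst .univ]; simp [hm]
  have e2 : κ.map Prod.snd Set.univ = m := by rw [Measure.map_apply measurable_snd .univ]; simp [hm]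
  refine ⟨m⁻¹ • (κ.map Prod.fst).prod (κ.map Prod.snd), Measure.smul_finite _ hmi, ?_, ?_,
    ⟨m⁻¹ * (C * C), ENNReal.mul_ne_top hmi (ENNReal.mul_ne_top hC hC), ?_⟩, ?_⟩
  · rw [Measure.map_smul, Measure.map_fst_prod, e2, smul_smul, ENNReal.inv_mul_cancel hm0 hmt,
      one_smul]
  · rw [Measure.map_smul, Measure.map_snd_prod, e1, smul_smul, ENNReal.inv_mul_cancel hm0 hmt,
      one_smul]
  · rw [← smul_smul]
    refine Measure.le_iff.2 fun s _ ↦ ?_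
    rw [Measure.smul_apply, Measure.smul_apply]
    exact mul_le_mul_right (prod_le_smul_prod h₁ h₂ s) _
  · have hA' : ∀ᵐ x ∂κ.map Prod.fst, x ∈ A :=
      (ae_map_iff measurable_fst.aemeasurable hA).2 (hκ.mono fun p hp ↦ hp.1)
    have hB' : ∀ᵐ x ∂κ.map Prod.snd, x ∈ B :=
      (ae_map_iff measurable_snd.aemeasurable hB).2 (hκ.mono fun p hp ↦ hp.2)
    have hAB : ∀ᵐ p ∂(κ.map Prod.fst).prod (κ.map Prod.snd), p ∈ A ×ˢ B := by
      filter_upwards [Measure.quasiMeasurePreserving_fst.ae hA',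
        Measure.quasiMeasurePreserving_snd.ae hB'] with p h1 h2 using ⟨h1, h2⟩
    set I := ∫⁻ p, c p ∂(κ.map Prod.fst).prod (κ.map Prod.snd) with hI
    -- compare with the value of `c` at one point `q` of the box, then average over `q` under `κ`
    have h1 : ∀ q ∈ A ×ˢ B, I ≤ (c q + δ) * (m * m) := by
      intro q hq
      calc I ≤ ∫⁻ _, (c q + δ) ∂(κ.map Prod.fst).prod (κ.map Prod.snd) :=
            lintegral_mono_ae (hAB.mono fun p hp ↦ hosc p hp q hq)
        _ = _ := by
          rw [lintegral_const, ← Set.univ_prod_univ, Measure.prod_prod, e1, e2]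
    have h2 : I * m ≤ (∫⁻ p, c p ∂κ + δ * m) * (m * m) := by
      calc I * m = ∫⁻ _, I ∂κ := by rw [lintegral_const]
        _ ≤ ∫⁻ q, (c q + δ) * (m * m) ∂κ := lintegral_mono_ae (hκ.mono h1)
        _ = _ := by
          rw [lintegral_mul_const _ (hc.add_const _), lintegral_add_left hc, lintegral_const]
    rw [lintegral_smul_measure, smul_eq_mul]
    rw [← mul_assoc, ENNReal.mul_le_mul_iff_left hm0 hmt, mul_comm _ m] at h2
    exact (ENNReal.inv_mul_le_iff hm0 hmt).2 h2

/-- Every finite plan `π` with absolutely continuous marginals is approximated by plans `π'` of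
finite divergence from `μ.prod ν`, with almost the same cost and with marginals that differ from
those of `π` by removing a small part `ρ`. The plan is cut along a countable partition into pieces
lying in open boxes of small oscillation of `d`; finitely many pieces are kept, only where the
marginal densities are bounded, and each is replaced by the product of its marginals. Neither
tightness of the measures nor uniform continuity of `d` is needed. -/
lemma exists_finite_klDiv_approx [TopologicalSpace α] [SecondCountableTopology α]
    [OpensMeasurableSpace α] (μ ν : Measure α) [IsProbabilityMeasure μ] [IsProbabilityMeasure ν]
    (π : Measure (α × α)) [IsFiniteMeasure π] (hπ₁ : π.map Prod.fst ≪ μ) (hπ₂ : π.map Prod.snd ≪ ν)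
    {d : α → α → ℝ} (hd : Continuous (Function.uncurry d)) {δ : ℝ} (hδ : 0 < δ) {ε : ℝ≥0∞}
    (hε : ε ≠ 0) :
    ∃ π' ρ : Measure (α × α), IsFiniteMeasure π' ∧ IsFiniteMeasure ρ ∧
      π'.map Prod.fst + ρ.map Prod.fst = π.map Prod.fst ∧
      π'.map Prod.snd + ρ.map Prod.snd = π.map Prod.snd ∧ ρ Set.univ < ε ∧
      klDiv π' (μ.prod ν) ≠ ∞ ∧
      transportCost d π' ≤ transportCost d π + ENNReal.ofReal δ * π Set.univ := by
  have hαne : Nonempty α := μ.nonempty_of_neZero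
  have hdm : Measurable fun p : α × α ↦ ENNReal.ofReal (d p.1 p.2) :=
    hd.measurable.ennreal_ofReal
  set f := (π.map Prod.fst).rnDeriv μ with hf
  set g := (π.map Prod.snd).rnDeriv ν with hg
  have hfm : Measurable f := Measure.measurable_rnDeriv _ _
  have hgm : Measurable g := Measure.measurable_rnDeriv _ _
  have hbox : ∀ p : α × α, ∃ u v : Set α, IsOpen u ∧ p.1 ∈ u ∧ IsOpen v ∧ p.2 ∈ v ∧
      ∀ q ∈ u ×ˢ v, |d q.1 q.2 - d p.1 p.2| < δ / 2 := by
    intro p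
    have : {q : α × α | |d q.1 q.2 - d p.1 p.2| < δ / 2} ∈ 𝓝 p := by
      have := Metric.continuousAt_iff'.1 (hd.continuousAt (x := p)) (δ / 2) (by positivity)
      simp only [Real.dist_eq, Function.uncurry] at this
      exact this
    obtain ⟨u, v, hu, hpu, hv, hpv, h⟩ := mem_nhds_prod_iff'.1 this
    exact ⟨u, v, hu, hpu, hv, hpv, fun q hq ↦ h hq⟩
  choose U V hU hUp hV hVp hUV using hbox
  obtain ⟨s, hs, hcov⟩ := TopologicalSpace.countable_cover_nhds
    (f := fun p ↦ U p ×ˢ V p) fun p ↦ ((hU p).prod (hV p)).mem_nhds ⟨hUp p, hVp p⟩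
  have hsne : s.Nonempty := by
    by_contra h
    rw [Set.not_nonempty_iff_eq_empty] at h
    simp only [h, Set.mem_empty_iff_false, Set.iUnion_of_empty, Set.iUnion_empty] at hcov
    exact Set.empty_ne_univ hcov
  obtain ⟨r, rfl⟩ := hs.exists_eq_range hsne
  set S : ℕ → Set (α × α) := disjointed fun k ↦ U (r k) ×ˢ V (r k) with hS
  have hSm : ∀ k, MeasurableSet (S k) :=
    .disjointed fun k ↦ (hU _).measurableSet.prod (hV _).measurableSet
  have hScov : ⋃ k, S k = Set.univ := by
    rw [hS, iUnion_disjointed]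
    simpa using hcov
  set F : ℕ → Set (α × α) := fun N ↦ {p | f p.1 ≤ N ∧ g p.2 ≤ N} with hF
  have hFm : ∀ N, MeasurableSet (F N) := fun N ↦
    (measurableSet_le (hfm.comp measurable_fst) measurable_const).inter
      (measurableSet_le (hgm.comp measurable_snd) measurable_const)
  -- the part of `π` that is kept: it exhausts `π` as `N → ∞`
  set G : ℕ → Set (α × α) := fun N ↦ ⋃ k ∈ Finset.range N, S k ∩ F N with hG
  have hGm : ∀ N, MeasurableSet (G N) := fun N ↦
    Finset.measurableSet_biUnion _ fun k _ ↦ (hSm k).inter (hFm N)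
  have hGmono : Monotone G := by
    intro M N hMN p hp
    simp only [hG, hF, Set.mem_iUnion, Finset.mem_range, Set.mem_inter_iff,
      Set.mem_ofPred_eq] at hp ⊢
    obtain ⟨k, hk, hkS, h1, h2⟩ := hp
    have hc : (M : ℝ≥0∞) ≤ N := by exact_mod_cast hMN
    exact ⟨k, hk.trans_le hMN, hkS, h1.trans hc, h2.trans hc⟩
  have hnull : π (⋂ N, (G N)ᶜ) = 0 := by
    have h1 : ∀ᵐ p ∂π, f p.1 < ∞ :=
      ae_of_ae_map measurable_fst.aemeasurable (hπ₁.ae_le (Measure.rnDeriv_lt_top _ μ))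
    have h2 : ∀ᵐ p ∂π, g p.2 < ∞ :=
      ae_of_ae_map measurable_snd.aemeasurable (hπ₂.ae_le (Measure.rnDeriv_lt_top _ ν))
    rw [measure_eq_zero_iff_ae_notMem]
    filter_upwards [h1, h2] with p hp1 hp2 hp
    obtain ⟨k, hk⟩ := Set.mem_iUnion.1 (hScov.symm ▸ Set.mem_univ p : p ∈ ⋃ k, S k)
    obtain ⟨N₁, hN₁⟩ := ENNReal.exists_nat_gt hp1.ne
    obtain ⟨N₂, hN₂⟩ := ENNReal.exists_nat_gt hp2.ne
    refine Set.mem_iInter.1 hp (max (max N₁ N₂) (k + 1)) ?_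
    simp only [hG, hF, Set.mem_iUnion, Finset.mem_range, Set.mem_inter_iff, Set.mem_ofPred_eq]
    refine ⟨k, by omega, hk, hN₁.le.trans ?_, hN₂.le.trans ?_⟩ <;>
    · norm_cast; omega
  obtain ⟨N, hN⟩ : ∃ N, π (G N)ᶜ < ε := by
    have := tendsto_measure_iInter_atTop (μ := π) (s := fun N ↦ (G N)ᶜ)
      (fun N ↦ (hGm N).compl.nullMeasurableSet)
      (fun M N h ↦ Set.compl_subset_compl.2 (hGmono h)) ⟨0, measure_ne_top _ _⟩
    rw [hnull] at this
    exact ((tendsto_order.1 this).2 ε (pos_iff_ne_zero.2 hε)).exists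
  have hdom₁ : ∀ k, (π.restrict (S k ∩ F N)).map Prod.fst ≤ (N : ℝ≥0∞) • μ := by
    intro k
    refine Measure.le_iff.2 fun A hA ↦ ?_
    have hA' : MeasurableSet (A ∩ {x | f x ≤ N}) := hA.inter (measurableSet_le hfm measurable_const)
    rw [Measure.map_apply measurable_fst hA, Measure.restrict_apply (measurable_fst hA)]
    calc _ ≤ π (Prod.fst ⁻¹' (A ∩ {x | f x ≤ N})) :=
          measure_mono fun p hp ↦ ⟨hp.1, hp.2.2.1⟩
      _ = ∫⁻ x in A ∩ {x | f x ≤ N}, f x ∂μ := by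
        rw [hf, Measure.setLIntegral_rnDeriv hπ₁, Measure.map_apply measurable_fst hA']
      _ ≤ ∫⁻ x in A ∩ {x | f x ≤ N}, N ∂μ := setLIntegral_mono' hA' fun x hx ↦ hx.2
      _ ≤ _ := by
        rw [setLIntegral_const, Measure.smul_apply, smul_eq_mul]
        gcongr
        exact Set.inter_subset_left
  have hdom₂ : ∀ k, (π.restrict (S k ∩ F N)).map Prod.snd ≤ (N : ℝ≥0∞) • ν := by
    intro k
    refine Measure.le_iff.2 fun A hA ↦ ?_
    have hA' : MeasurableSet (A ∩ {x | g x ≤ N}) := hA.inter (measurableSet_le hgm measurable_const)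
    rw [Measure.map_apply measurable_snd hA, Measure.restrict_apply (measurable_snd hA)]
    calc _ ≤ π (Prod.snd ⁻¹' (A ∩ {x | g x ≤ N})) :=
          measure_mono fun p hp ↦ ⟨hp.1, hp.2.2.2⟩
      _ = ∫⁻ x in A ∩ {x | g x ≤ N}, g x ∂ν := by
        rw [hg, Measure.setLIntegral_rnDeriv hπ₂, Measure.map_apply measurable_snd hA']
      _ ≤ ∫⁻ x in A ∩ {x | g x ≤ N}, N ∂ν := setLIntegral_mono' hA' fun x hx ↦ hx.2
      _ ≤ _ := by
        rw [setLIntegral_const, Measure.smul_apply, smul_eq_mul]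
        gcongr
        exact Set.inter_subset_left
  have hrep := fun k ↦ exists_product_replacement (κ := π.restrict (S k ∩ F N)) (μ := μ) (ν := ν)
    (hU (r k)).measurableSet (hV (r k)).measurableSet
    ((ae_restrict_iff' ((hSm k).inter (hFm N))).2 (.of_forall fun p hp ↦
      disjointed_le (fun k ↦ U (r k) ×ˢ V (r k)) k hp.1)) hdm (δ := ENNReal.ofReal δ)
    (fun p hp q hq ↦ by
      refine (ENNReal.ofReal_le_ofReal ?_).trans ENNReal.ofReal_add_le
      have h1 := abs_lt.1 (hUV (r k) p hp)
      have h2 := abs_lt.1 (hUV (r k) q hq)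
      linarith [h1.2, h2.1])
    (ENNReal.natCast_ne_top N) (hdom₁ k) (hdom₂ k)
  choose κ hκfin hκ₁ hκ₂ hκC hκc using hrep
  choose C hC hκC using hκC
  have hdisj : Set.PairwiseDisjoint (Finset.range N : Set ℕ) fun k ↦ S k ∩ F N := fun i _ j _ hij ↦
    (disjoint_disjointed _ hij).mono Set.inter_subset_left Set.inter_subset_left
  have hsum : ∑ k ∈ Finset.range N, π.restrict (S k ∩ F N) = π.restrict (G N) := by
    rw [hG, Measure.restrict_biUnion_finset hdisj fun k ↦ (hSm k).inter (hFm N),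
      Measure.sum_fintype,
      Finset.sum_coe_sort (Finset.range N) fun k ↦ π.restrict (S k ∩ F N)]
  have hmarg : ∀ φ : α × α → α, Measurable φ →
      (∀ k, (κ k).map φ = (π.restrict (S k ∩ F N)).map φ) →
      (∑ k ∈ Finset.range N, κ k).map φ + (π.restrict (G N)ᶜ).map φ = π.map φ := by
    intro φ hφ hκφ
    conv_rhs => rw [← Measure.restrict_add_restrict_compl (μ := π) (hGm N),
      Measure.map_add _ _ hφ, ← hsum]
    congr 1
    ext A hA
    rw [Measure.map_apply hφ hA, Measure.map_apply hφ hA, Measure.finsetSum_apply,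
      Measure.finsetSum_apply]
    refine Finset.sum_congr rfl fun k _ ↦ ?_
    rw [← Measure.map_apply hφ hA, hκφ, Measure.map_apply hφ hA]
  refine ⟨∑ k ∈ Finset.range N, κ k, π.restrict (G N)ᶜ, inferInstance, inferInstance,
    hmarg _ measurable_fst hκ₁, hmarg _ measurable_snd hκ₂, ?_, ?_, ?_⟩
  · rwa [Measure.restrict_apply_univ]
  · refine klDiv_ne_top_of_le_smul (C := ∑ k ∈ Finset.range N, C k)
      (ENNReal.sum_ne_top.2 fun k _ ↦ hC k) ?_
    rw [Finset.sum_smul]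
    exact Finset.sum_le_sum fun k _ ↦ hκC k
  · rw [transportCost, lintegral_finsetSum_measure]
    calc _ ≤ ∑ k ∈ Finset.range N, (∫⁻ p, ENNReal.ofReal (d p.1 p.2) ∂(π.restrict (S k ∩ F N)) +
          ENNReal.ofReal δ * π.restrict (S k ∩ F N) Set.univ) :=
          Finset.sum_le_sum fun k _ ↦ hκc k
      _ = ∫⁻ p, ENNReal.ofReal (d p.1 p.2) ∂(π.restrict (G N)) +
          ENNReal.ofReal δ * π.restrict (G N) Set.univ := by
        rw [Finset.sum_add_distrib, ← Finset.mul_sum, ← lintegral_finsetSum_measure,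
          ← Measure.finsetSum_apply, hsum]
      _ ≤ _ := add_le_add (lintegral_mono' Measure.restrict_le_self le_rfl)
        (mul_le_mul_right (Measure.restrict_le_self _) _)

lemma uot_le_uotReg (d : α → α → ℝ) (η₁ η₂ lam : ℝ) (μ ν : Measure α) :
    uot d η₁ η₂ μ ν ≤ uotReg d η₁ η₂ lam μ ν := by
  refine iInf₂_mono fun π _ ↦ ?_
  gcongr
  exact le_self_add

lemma uot_ne_top (d : α → α → ℝ) (η₁ η₂ : ℝ) (μ ν : Measure α) [IsFiniteMeasure μ]
    [IsFiniteMeasure ν] : uot d η₁ η₂ μ ν ≠ ∞ := by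
  refine ne_top_of_le_ne_top ?_ (iInf₂_le (0 : Measure (α × α)) (by infer_instance))
  simp [transportCost, ENNReal.mul_eq_top]

/-- The diagonal coupling has no cost. -/
lemma uot_self {d : α → α → ℝ} (hd : Measurable (Function.uncurry d)) (hd0 : ∀ x, d x x = 0)
    (η₁ η₂ : ℝ) (μ : Measure α) [IsFiniteMeasure μ] :
    uot d η₁ η₂ μ μ = 0 := by
  have hm : Measurable fun x : α ↦ (x, x) := by fun_prop
  refine le_antisymm ((iInf₂_le (μ.map fun x ↦ (x, x)) (by infer_instance)).trans (le_of_eq ?_))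
    zero_le
  rw [Measure.map_map measurable_fst hm, Measure.map_map measurable_snd hm, transportCost,
    lintegral_map (f := fun p : α × α ↦ ENNReal.ofReal (d p.1 p.2)) hd.ennreal_ofReal hm]
  simp [Function.comp_def, hd0]

/-- As the entropic penalty vanishes, the regularized cost tends to the unregularized one. -/
theorem tendsto_uotReg_atTop [TopologicalSpace α] [SecondCountableTopology α]
    [OpensMeasurableSpace α] (μ ν : Measure α) [IsProbabilityMeasure μ] [IsProbabilityMeasure ν]
    {d : α → α → ℝ} (hd : Continuous (Function.uncurry d)) {η₁ η₂ : ℝ} (hη₁ : 0 < η₁)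
    (hη₂ : 0 < η₂) :
    Tendsto (fun lam : ℝ ↦ uotReg d η₁ η₂ lam μ ν) atTop (𝓝 (uot d η₁ η₂ μ ν)) := by
  refine tendsto_order.2 ⟨fun a ha ↦ .of_forall fun lam ↦ ha.trans_le (uot_le_uotReg ..),
    fun b hb ↦ ?_⟩
  simp only [uot, iInf_lt_iff] at hb
  obtain ⟨π, hπ, hb⟩ := hb
  have hkl₁ : klDiv (π.map Prod.fst) μ ≠ ∞ := by
    intro h
    simp [h, ENNReal.mul_top, hη₁] at hb
  have hkl₂ : klDiv (π.map Prod.snd) ν ≠ ∞ := by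
    intro h
    simp [h, ENNReal.mul_top, hη₂] at hb
  -- leave room below `b` for the cost error `δ`, then for the loss of marginal mass `r`
  obtain ⟨δ, hδb, hδ⟩ : ∃ δ : ℝ, transportCost d π + ENNReal.ofReal δ * π Set.univ
      + ENNReal.ofReal η₁ * klDiv (π.map Prod.fst) μ
      + ENNReal.ofReal η₂ * klDiv (π.map Prod.snd) ν < b ∧ 0 < δ := by
    have hc : Continuous fun δ : ℝ ↦ transportCost d π + ENNReal.ofReal δ * π Set.univ
      + ENNReal.ofReal η₁ * klDiv (π.map Prod.fst) μ
      + ENNReal.ofReal η₂ * klDiv (π.map Prod.snd) ν := by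
      have := (ENNReal.continuous_mul_const (measure_ne_top π Set.univ)).comp
        ENNReal.continuous_ofReal
      exact ((continuous_const.add this).add continuous_const).add continuous_const
    have h0 := (hc.tendsto 0).mono_left (nhdsWithin_le_nhds (s := Set.Ioi 0))
    have := ((tendsto_order.1 h0).2 b (by simpa using hb)).and self_mem_nhdsWithin
    exact this.exists
  obtain ⟨r₀, hr₀, hr⟩ : ∃ r₀ > 0, ∀ r : ℝ, |r| < r₀ →
      transportCost d π + ENNReal.ofReal δ * π Set.univ
      + ENNReal.ofReal η₁ * (klDiv (π.map Prod.fst) μ + ENNReal.ofReal (1 - klFun r))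
      + ENNReal.ofReal η₂ * (klDiv (π.map Prod.snd) ν + ENNReal.ofReal (1 - klFun r)) < b := by
    have hω : Continuous fun r ↦ ENNReal.ofReal (1 - klFun r) :=
      ENNReal.continuous_ofReal.comp (continuous_const.sub continuous_klFun)
    have hc : Continuous fun r : ℝ ↦ transportCost d π + ENNReal.ofReal δ * π Set.univ
      + ENNReal.ofReal η₁ * (klDiv (π.map Prod.fst) μ + ENNReal.ofReal (1 - klFun r))
      + ENNReal.ofReal η₂ * (klDiv (π.map Prod.snd) ν + ENNReal.ofReal (1 - klFun r)) :=
      (continuous_const.add ((ENNReal.continuous_const_mul ENNReal.ofReal_ne_top).comp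
        (continuous_const.add hω))).add ((ENNReal.continuous_const_mul ENNReal.ofReal_ne_top).comp
        (continuous_const.add hω))
    have := (tendsto_order.1 (hc.tendsto 0)).2 b (by simpa [klFun_zero] using hδb)
    simpa [Metric.eventually_nhds_iff] using this
  obtain ⟨π', ρ, hπ', hρ, h₁, h₂, hρr, hK, hcost⟩ := exists_finite_klDiv_approx μ ν π
    (klDiv_ne_top_iff.1 hkl₁).1 (klDiv_ne_top_iff.1 hkl₂).1 hd hδ
    (ε := ENNReal.ofReal r₀) (by simpa)
  have hρ' : |ρ.real Set.univ| < r₀ := by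
    rw [abs_of_nonneg measureReal_nonneg]
    exact (ENNReal.lt_ofReal_iff_toReal_lt (measure_ne_top _ _)).1 hρr
  have hρ₁ : (ρ.map Prod.fst).real Set.univ = ρ.real Set.univ := by
    rw [map_measureReal_apply measurable_fst .univ, Set.preimage_univ]
  have hρ₂ : (ρ.map Prod.snd).real Set.univ = ρ.real Set.univ := by
    rw [map_measureReal_apply measurable_snd .univ, Set.preimage_univ]
  have hlt : transportCost d π' + ENNReal.ofReal η₁ * klDiv (π'.map Prod.fst) μ
      + ENNReal.ofReal η₂ * klDiv (π'.map Prod.snd) ν < b := by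
    refine lt_of_le_of_lt ?_ (hr _ hρ')
    have k₁ := klDiv_le_klDiv_add (π'.map Prod.fst) (ρ.map Prod.fst) μ
    have k₂ := klDiv_le_klDiv_add (π'.map Prod.snd) (ρ.map Prod.snd) ν
    rw [h₁, hρ₁] at k₁
    rw [h₂, hρ₂] at k₂
    gcongr
  have hlim : Tendsto (fun lam : ℝ ↦ transportCost d π'
      + ENNReal.ofReal (1 / lam) * klDiv π' (μ.prod ν)
      + ENNReal.ofReal η₁ * klDiv (π'.map Prod.fst) μ
      + ENNReal.ofReal η₂ * klDiv (π'.map Prod.snd) ν) atTop (𝓝 (transportCost d π' +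
      ENNReal.ofReal 0 * klDiv π' (μ.prod ν) + ENNReal.ofReal η₁ * klDiv (π'.map Prod.fst) μ
      + ENNReal.ofReal η₂ * klDiv (π'.map Prod.snd) ν)) := by
    refine Tendsto.add (Tendsto.add (tendsto_const_nhds.add ?_) tendsto_const_nhds)
      tendsto_const_nhds
    refine ((ENNReal.continuous_mul_const hK).tendsto _).comp
      ((ENNReal.continuous_ofReal.tendsto _).comp ?_)
    exact tendsto_const_nhds.div_atTop tendsto_id
  filter_upwards [(tendsto_order.1 hlim).2 b (by simpa using hlt)] with lam hlam
  exact lt_of_le_of_lt (iInf₂_le π' hπ') hlam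

/-! ### Dominating entropic penalty -/

/-- The independent coupling is a competitor with vanishing divergences. -/
lemma uotReg_le_transportCost_prod (d : α → α → ℝ) (η₁ η₂ lam : ℝ) (μ ν : Measure α)
    [IsProbabilityMeasure μ] [IsProbabilityMeasure ν] :
    uotReg d η₁ η₂ lam μ ν ≤ transportCost d (μ.prod ν) := by
  refine (iInf₂_le (μ.prod ν) (by infer_instance)).trans (le_of_eq ?_)
  simp

lemma lintegral_le_uotReg {d : α → α → ℝ} (hd : Measurable (Function.uncurry d))
    (hd0 : ∀ x y, 0 ≤ d x y) (η₁ η₂ : ℝ) {lam : ℝ} (hlam : 0 < lam) (μ ν : Measure α)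
    [IsFiniteMeasure μ] [IsFiniteMeasure ν] :
    ∫⁻ p, ENNReal.ofReal ((1 - Real.exp (-(lam * d p.1 p.2))) / lam) ∂(μ.prod ν) ≤
      uotReg d η₁ η₂ lam μ ν := by
  refine le_iInf₂ fun π _ ↦ ?_
  rw [add_assoc]
  exact (lintegral_one_sub_exp_le (c := Function.uncurry d) hd (fun p ↦ hd0 _ _) hlam π
    (μ.prod ν)).trans le_self_add

lemma uotReg_mono (d : α → α → ℝ) (lam : ℝ) (μ ν : Measure α) :
    Monotone fun η : ℝ × ℝ ↦ uotReg d η.1 η.2 lam μ ν := by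
  intro η η' h
  refine iInf₂_mono fun π _ ↦ ?_
  have h1 := h.1
  have h2 := h.2
  gcongr

/-- The limit over the marginal parameters exists by monotonicity and the bound by the independent
coupling; it is the supremum. -/
lemma tendsto_uotReg_marginal (d : α → α → ℝ) (lam : ℝ) (μ ν : Measure α)
    [IsProbabilityMeasure μ] [IsProbabilityMeasure ν] (hfin : transportCost d (μ.prod ν) ≠ ∞) :
    Tendsto (fun η : ℝ × ℝ ↦ (uotReg d η.1 η.2 lam μ ν).toReal) (atTop ×ˢ atTop)
      (𝓝 (⨆ η : ℝ × ℝ, uotReg d η.1 η.2 lam μ ν).toReal) := by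
  rw [prod_atTop_atTop_eq]
  exact (ENNReal.tendsto_toReal (ne_top_of_le_ne_top hfin
    (iSup_le fun η ↦ uotReg_le_transportCost_prod ..))).comp
      (tendsto_atTop_iSup (uotReg_mono d lam μ ν))

/-- As the entropic penalty dominates, the cost of the independent coupling remains. The lower bound
of `lintegral_le_uotReg` does not depend on the marginal parameters, so it applies to the
supremum. -/
lemma tendsto_iSup_uotReg {d : α → α → ℝ} (hd : Measurable (Function.uncurry d))
    (hd0 : ∀ x y, 0 ≤ d x y) (μ ν : Measure α)
    [IsProbabilityMeasure μ] [IsProbabilityMeasure ν] (hfin : transportCost d (μ.prod ν) ≠ ∞) :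
    Tendsto (fun lam : ℝ ↦ (⨆ η : ℝ × ℝ, uotReg d η.1 η.2 lam μ ν).toReal) (𝓝[>] 0)
      (𝓝 (transportCost d (μ.prod ν)).toReal) := by
  refine (ENNReal.tendsto_toReal hfin).comp ?_
  refine tendsto_of_tendsto_of_tendsto_of_le_of_le'
    (tendsto_lintegral_one_sub_exp (c := Function.uncurry d) hd (μ.prod ν) hfin)
    tendsto_const_nhds ?_ (.of_forall fun lam ↦ iSup_le fun η ↦ uotReg_le_transportCost_prod ..)
  filter_upwards [self_mem_nhdsWithin] with lam hlam
  exact (lintegral_le_uotReg hd hd0 0 0 hlam μ ν).trans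
    (le_iSup (fun η : ℝ × ℝ ↦ uotReg d η.1 η.2 lam μ ν) (0, 0))

/-! ### The energy inequality -/

lemma lintegral_abs_gaussianReal_pos : 0 < ∫⁻ t, ENNReal.ofReal |t| ∂(gaussianReal 0 1) := by
  have := nullSingletonClass_gaussianReal (μ := 0) (v := 1) one_ne_zero
  rw [lintegral_pos_iff_support (by fun_prop)]
  have : (Function.support fun t : ℝ ↦ ENNReal.ofReal |t|) = {0}ᶜ := by
    ext t; simp
  rw [this, prob_compl_eq_one_sub (measurableSet_singleton 0)]
  simp

lemma lintegral_abs_gaussianReal_ne_top : ∫⁻ t, ENNReal.ofReal |t| ∂(gaussianReal 0 1) ≠ ∞ := by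
  have h : Integrable (fun t : ℝ ↦ t) (gaussianReal 0 1) :=
    IsGaussian.integrable_id
  have := h.abs.lintegral_lt_top
  exact this.ne

/-- If `g` is a standard Gaussian vector, then `⟪g, v⟫` is a centred Gaussian of standard deviation
`‖v‖`. -/
lemma lintegral_abs_inner {E : Type*} [NormedAddCommGroup E] [InnerProductSpace ℝ E]
    [FiniteDimensional ℝ E] [MeasurableSpace E] [BorelSpace E] (v : E) :
    ∫⁻ g, ENNReal.ofReal |inner ℝ g v| ∂(stdGaussian E) =
      ENNReal.ofReal ‖v‖ * ∫⁻ t, ENNReal.ofReal |t| ∂(gaussianReal 0 1) := by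
  have h : (stdGaussian E).map (fun g ↦ inner ℝ g v) =
      (gaussianReal 0 1).map (fun t ↦ ‖v‖ * t) := by
    rw [gaussianReal_map_const_mul]
    apply Measure.ext_of_charFun
    ext t
    rw [charFun_gaussianReal, charFun_apply_real, integral_map (by fun_prop) (by fun_prop)]
    have := charFun_stdGaussian (E := E) (t • v)
    rw [charFun_apply] at this
    simp only [inner_smul_right] at this
    push_cast at this
    rw [this]
    have habs : ((|t| : ℝ) : ℂ) ^ 2 = (t : ℂ) ^ 2 := by rw [← Complex.ofReal_pow, sq_abs]; simp
    simp [norm_smul, mul_pow, habs]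
    ring_nf
  have h2 := congrArg (fun m ↦ ∫⁻ t, ENNReal.ofReal |t| ∂m) h
  rw [lintegral_map (by fun_prop) (by fun_prop), lintegral_map (by fun_prop) (by fun_prop)] at h2
  rw [h2, ← lintegral_const_mul _ (by fun_prop)]
  refine lintegral_congr fun t ↦ ?_
  rw [abs_mul, abs_norm, ENNReal.ofReal_mul (norm_nonneg v)]

/-- The distance of two reals is the measure of the thresholds that separate them. -/
lemma ofReal_abs_sub_eq_lintegral (a b : ℝ) :
    ENNReal.ofReal |a - b| = ∫⁻ t, ((Set.Iio a).indicator 1 t * (Set.Iio b)ᶜ.indicator 1 t +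
      (Set.Iio a)ᶜ.indicator 1 t * (Set.Iio b).indicator 1 t : ℝ≥0∞) := by
  have : ∀ t, ((Set.Iio a).indicator 1 t * (Set.Iio b)ᶜ.indicator 1 t +
      (Set.Iio a)ᶜ.indicator 1 t * (Set.Iio b).indicator 1 t : ℝ≥0∞) =
      (Set.Ico (min a b) (max a b)).indicator 1 t := by
    intro t
    rcases lt_or_ge t a with h1 | h1 <;> rcases lt_or_ge t b with h2 | h2 <;>
      simp [Set.indicator, h1, h2, not_lt.2, not_le.2]
  simp_rw [this]
  rw [lintegral_indicator_one measurableSet_Ico, Real.volume_Ico, max_sub_min_eq_abs, abs_sub_comm]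

/-- The energy inequality for the cost that is `1` if exactly one of two points lies in `A` and `0`
otherwise. With `p = P A` and `q = Q A`, the difference of the two sides is `2 * (p - q) ^ 2`. -/
lemma lintegral_separation_le {α : Type*} [MeasurableSpace α] (P Q : Measure α)
    [IsProbabilityMeasure P] [IsProbabilityMeasure Q] {A : Set α} (hA : MeasurableSet A) :
    ∫⁻ x, ∫⁻ y, (A.indicator 1 x * Aᶜ.indicator 1 y + Aᶜ.indicator 1 x * A.indicator 1 y) ∂P ∂P +
      ∫⁻ x, ∫⁻ y, (A.indicator 1 x * Aᶜ.indicator 1 y + Aᶜ.indicator 1 x * A.indicator 1 y) ∂Q ∂Q ≤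
    2 * ∫⁻ x, ∫⁻ y,
      (A.indicator 1 x * Aᶜ.indicator 1 y + Aᶜ.indicator 1 x * A.indicator 1 y) ∂Q ∂P := by
  have h1 : Measurable (A.indicator (1 : α → ℝ≥0∞)) := measurable_one.indicator hA
  have h2 : Measurable (Aᶜ.indicator (1 : α → ℝ≥0∞)) := measurable_one.indicator hA.compl
  have key : ∀ μ ν : Measure α, ∫⁻ x, ∫⁻ y,
      (A.indicator 1 x * Aᶜ.indicator 1 y + Aᶜ.indicator 1 x * A.indicator 1 y) ∂ν ∂μ =
      μ A * ν Aᶜ + μ Aᶜ * ν A := by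
    intro μ ν
    have (x : α) : ∫⁻ y,
      (A.indicator 1 x * Aᶜ.indicator 1 y + Aᶜ.indicator 1 x * A.indicator 1 y) ∂ν =
        A.indicator 1 x * ν Aᶜ + Aᶜ.indicator 1 x * ν A := by
      rw [lintegral_add_left (h2.const_mul _), lintegral_const_mul _ h2, lintegral_const_mul _ h1,
        lintegral_indicator_one hA, lintegral_indicator_one hA.compl]
    simp_rw [this]
    rw [lintegral_add_left (h1.mul_const _), lintegral_mul_const _ h2, lintegral_mul_const _ h1,
        lintegral_indicator_one hA, lintegral_indicator_one hA.compl]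
  have hreal : ∀ μ : Measure α, [IsProbabilityMeasure μ] → ∃ p : ℝ, 0 ≤ p ∧ p ≤ 1 ∧
      μ A = ENNReal.ofReal p ∧ μ Aᶜ = ENNReal.ofReal (1 - p) := by
    intro μ _
    refine ⟨μ.real A, measureReal_nonneg, measureReal_le_one, by simp, ?_⟩
    rw [← probReal_compl_eq_one_sub hA, ofReal_measureReal]
  obtain ⟨p, hp0, hp1, hp, hp'⟩ := hreal P
  obtain ⟨q, hq0, hq1, hq, hq'⟩ := hreal Q
  have hp2 := sub_nonneg.2 hp1
  have hq2 := sub_nonneg.2 hq1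
  rw [key, key, key, hp, hp', hq, hq', ← ENNReal.ofReal_ofNat 2]
  simp only [← ENNReal.ofReal_mul, hp0, hq0, hp2, hq2]
  rw [← ENNReal.ofReal_add (by positivity) (by positivity),
    ← ENNReal.ofReal_add (by positivity) (by positivity),
    ← ENNReal.ofReal_add (by positivity) (by positivity),
    ← ENNReal.ofReal_add (by positivity) (by positivity), ← ENNReal.ofReal_mul (by norm_num)]
  refine ENNReal.ofReal_le_ofReal ?_
  nlinarith [sq_nonneg (p - q)]

/-- The energy inequality for a real-valued statistic, averaged from `lintegral_separation_le` over
all thresholds. -/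
lemma lintegral_abs_sub_le {α : Type*} [MeasurableSpace α] (P Q : Measure α)
    [IsProbabilityMeasure P] [IsProbabilityMeasure Q] {f : α → ℝ} (hf : Measurable f) :
    ∫⁻ x, ∫⁻ y, ENNReal.ofReal |f x - f y| ∂P ∂P + ∫⁻ x, ∫⁻ y, ENNReal.ofReal |f x - f y| ∂Q ∂Q ≤
    2 * ∫⁻ x, ∫⁻ y, ENNReal.ofReal |f x - f y| ∂Q ∂P := by
  set F : α → α → ℝ → ℝ≥0∞ := fun x y t ↦
    ((Set.Iio (f x)).indicator 1 t * (Set.Iio (f y))ᶜ.indicator 1 t +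
      (Set.Iio (f x))ᶜ.indicator 1 t * (Set.Iio (f y)).indicator 1 t : ℝ≥0∞) with hF
  have hFm : Measurable (fun p : (α × α) × ℝ ↦ F p.1.1 p.1.2 p.2) := by
    have h1 : Measurable fun p : (α × α) × ℝ ↦ (Set.Iio (f p.1.1)).indicator (1 : ℝ → ℝ≥0∞) p.2 :=
      measurable_one.indicator (s := {p : (α × α) × ℝ | p.2 < f p.1.1})
        (measurableSet_lt (by fun_prop) (by fun_prop))
    have h2 : Measurable fun p : (α × α) × ℝ ↦ (Set.Iio (f p.1.2)).indicator (1 : ℝ → ℝ≥0∞) p.2 :=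
      measurable_one.indicator (s := {p : (α × α) × ℝ | p.2 < f p.1.2})
        (measurableSet_lt (by fun_prop) (by fun_prop))
    have h3 : Measurable fun p : (α × α) × ℝ ↦ (Set.Iio (f p.1.1))ᶜ.indicator (1 : ℝ → ℝ≥0∞) p.2 :=
      measurable_one.indicator (s := {p : (α × α) × ℝ | p.2 < f p.1.1}ᶜ)
        (measurableSet_lt (by fun_prop) (by fun_prop)).compl
    have h4 : Measurable fun p : (α × α) × ℝ ↦ (Set.Iio (f p.1.2))ᶜ.indicator (1 : ℝ → ℝ≥0∞) p.2 :=
      measurable_one.indicator (s := {p : (α × α) × ℝ | p.2 < f p.1.2}ᶜ)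
        (measurableSet_lt (by fun_prop) (by fun_prop)).compl
    exact (h1.mul h4).add (h3.mul h2)
  have swap : ∀ μ ν : Measure α, [IsProbabilityMeasure μ] → [IsProbabilityMeasure ν] →
      ∫⁻ x, ∫⁻ y, ENNReal.ofReal |f x - f y| ∂ν ∂μ = ∫⁻ t, ∫⁻ x, ∫⁻ y, F x y t ∂ν ∂μ := by
    intro μ ν _ _
    have hFx (x : α) : Measurable (fun p : α × ℝ ↦ F x p.1 p.2) :=
      hFm.comp (f := fun p : α × ℝ ↦ ((x, p.1), p.2)) (by fun_prop)
    simp_rw [ofReal_abs_sub_eq_lintegral]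
    have e1 (x : α) : ∫⁻ y, ∫⁻ t, F x y t ∂volume ∂ν = ∫⁻ t, ∫⁻ y, F x y t ∂ν :=
      lintegral_lintegral_swap (hFx x).aemeasurable
    rw [lintegral_congr e1]
    refine lintegral_lintegral_swap ?_
    refine Measurable.aemeasurable ?_
    refine Measurable.lintegral_prod_right' (f := fun q : (α × ℝ) × α ↦ F q.1.1 q.2 q.1.2) ?_
    exact hFm.comp (f := fun q : (α × ℝ) × α ↦ ((q.1.1, q.2), q.1.2)) (by fun_prop)
  have meas : ∀ μ ν : Measure α, [IsProbabilityMeasure μ] → [IsProbabilityMeasure ν] →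
      Measurable fun t ↦ ∫⁻ x, ∫⁻ y, F x y t ∂ν ∂μ := by
    intro μ ν _ _
    refine Measurable.lintegral_prod_right' (f := fun q : ℝ × α ↦ ∫⁻ y, F q.2 y q.1 ∂ν) ?_
    refine Measurable.lintegral_prod_right' (f := fun q : (ℝ × α) × α ↦ F q.1.2 q.2 q.1.1) ?_
    exact hFm.comp (f := fun q : (ℝ × α) × α ↦ ((q.1.2, q.2), q.1.1)) (by fun_prop)
  rw [swap P P, swap Q Q, swap P Q, ← lintegral_add_left (meas P P),
    ← lintegral_const_mul _ (meas P Q)]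
  refine lintegral_mono fun t ↦ ?_
  exact lintegral_separation_le P Q (A := {x | t < f x}) (measurableSet_lt measurable_const hf)

/-- The energy inequality `E‖X - X'‖ + E‖Y - Y'‖ ≤ 2 E‖X - Y‖`: by `lintegral_abs_inner`, the norm
is a Gaussian average of one-dimensional distances. -/
lemma lintegral_norm_sub_le {E : Type*} [NormedAddCommGroup E] [InnerProductSpace ℝ E]
    [FiniteDimensional ℝ E] [MeasurableSpace E] [BorelSpace E]
    {α : Type*} [MeasurableSpace α] (P Q : Measure α)
    [IsProbabilityMeasure P] [IsProbabilityMeasure Q] {f : α → E} (hf : Measurable f) :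
    ∫⁻ x, ∫⁻ y, ENNReal.ofReal ‖f x - f y‖ ∂P ∂P + ∫⁻ x, ∫⁻ y, ENNReal.ofReal ‖f x - f y‖ ∂Q ∂Q ≤
    2 * ∫⁻ x, ∫⁻ y, ENNReal.ofReal ‖f x - f y‖ ∂Q ∂P := by
  set c := ∫⁻ t, ENNReal.ofReal |t| ∂(gaussianReal 0 1) with hc
  have meas {β : Type _} [MeasurableSpace β] {u v : β → α} {w : β → E} (hu : Measurable u)
      (hv : Measurable v) (hw : Measurable w) :
      Measurable fun q ↦ ENNReal.ofReal |inner ℝ (w q) (f (u q)) - inner ℝ (w q) (f (v q))| := by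
    fun_prop
  have measn : Measurable fun p : α × α ↦ ENNReal.ofReal ‖f p.1 - f p.2‖ := by fun_prop
  have swap : ∀ μ ν : Measure α, [IsProbabilityMeasure μ] → [IsProbabilityMeasure ν] →
      c * ∫⁻ x, ∫⁻ y, ENNReal.ofReal ‖f x - f y‖ ∂ν ∂μ =
      ∫⁻ g, ∫⁻ x, ∫⁻ y, ENNReal.ofReal |inner ℝ g (f x) - inner ℝ g (f y)| ∂ν ∂μ
        ∂(stdGaussian E) := by
    intro μ ν _ _
    rw [← lintegral_const_mul _ measn.lintegral_prod_right']
    have e1 (x : α) : c * ∫⁻ y, ENNReal.ofReal ‖f x - f y‖ ∂ν = ∫⁻ g, ∫⁻ y,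
        ENNReal.ofReal |inner ℝ g (f x) - inner ℝ g (f y)| ∂ν ∂(stdGaussian E) := by
      rw [← lintegral_const_mul _ (by fun_prop), lintegral_lintegral_swap
        (meas measurable_const measurable_snd measurable_fst).aemeasurable]
      refine lintegral_congr fun y ↦ ?_
      simp_rw [← inner_sub_right]
      rw [lintegral_abs_inner, mul_comm]
    rw [lintegral_congr e1]
    refine lintegral_lintegral_swap (Measurable.aemeasurable ?_)
    exact Measurable.lintegral_prod_right' (f := fun q : (α × E) × α ↦
        ENNReal.ofReal |inner ℝ q.1.2 (f q.1.1) - inner ℝ q.1.2 (f q.2)|)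
      (meas (by fun_prop) (by fun_prop) (by fun_prop))
  have meas' : ∀ μ ν : Measure α, [IsProbabilityMeasure μ] → [IsProbabilityMeasure ν] →
      Measurable fun g : E ↦
        ∫⁻ x, ∫⁻ y, ENNReal.ofReal |inner ℝ g (f x) - inner ℝ g (f y)| ∂ν ∂μ := by
    intro μ ν _ _
    refine Measurable.lintegral_prod_right' (f := fun q : E × α ↦
      ∫⁻ y, ENNReal.ofReal |inner ℝ q.1 (f q.2) - inner ℝ q.1 (f y)| ∂ν) ?_
    exact Measurable.lintegral_prod_right' (f := fun q : (E × α) × α ↦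
        ENNReal.ofReal |inner ℝ q.1.1 (f q.1.2) - inner ℝ q.1.1 (f q.2)|)
      (meas (by fun_prop) (by fun_prop) (by fun_prop))
  rw [← ENNReal.mul_le_mul_iff_right lintegral_abs_gaussianReal_pos.ne'
    lintegral_abs_gaussianReal_ne_top, ← hc, mul_add,
    mul_left_comm, swap P P, swap Q Q, swap P Q, ← lintegral_add_left (meas' P P),
    ← lintegral_const_mul _ (meas' P Q)]
  exact lintegral_mono fun g ↦ lintegral_abs_sub_le P Q (by fun_prop)

/-! ### The Euclidean cost and the energy kernel -/

variable {n : ℕ} {X : Set (EuclideanSpace ℝ (Fin n))}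

lemma continuous_euclideanCost :
    Continuous (Function.uncurry (euclideanCost : X → X → ℝ)) := by
  unfold euclideanCost Function.uncurry
  fun_prop

lemma integrable_euclideanCost {μ ν : Measure X} [IsProbabilityMeasure μ] [IsProbabilityMeasure ν]
    (hμ : Integrable (fun x : X ↦ ‖(x : EuclideanSpace ℝ (Fin n))‖) μ)
    (hν : Integrable (fun x : X ↦ ‖(x : EuclideanSpace ℝ (Fin n))‖) ν) :
    Integrable (fun p : X × X ↦ euclideanCost p.1 p.2) (μ.prod ν) := by
  refine ((hμ.comp_fst ν).add (hν.comp_snd μ)).mono'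
    continuous_euclideanCost.aestronglyMeasurable (.of_forall fun p ↦ ?_)
  rw [Real.norm_eq_abs, euclideanCost, abs_norm]
  exact norm_sub_le _ _

lemma transportCost_euclideanCost_prod_ne_top {μ ν : Measure X} [IsProbabilityMeasure μ]
    [IsProbabilityMeasure ν]
    (hμ : Integrable (fun x : X ↦ ‖(x : EuclideanSpace ℝ (Fin n))‖) μ)
    (hν : Integrable (fun x : X ↦ ‖(x : EuclideanSpace ℝ (Fin n))‖) ν) :
    transportCost euclideanCost (μ.prod ν) ≠ ∞ :=
  (integrable_euclideanCost hμ hν).lintegral_lt_top.ne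

lemma integral_energyKernel {μ ν : Measure X} [IsProbabilityMeasure μ] [IsProbabilityMeasure ν]
    (hμ : Integrable (fun x : X ↦ ‖(x : EuclideanSpace ℝ (Fin n))‖) μ)
    (hν : Integrable (fun x : X ↦ ‖(x : EuclideanSpace ℝ (Fin n))‖) ν) :
    ∫ x, ∫ y, energyKernel x y ∂ν ∂μ = -(transportCost euclideanCost (μ.prod ν)).toReal := by
  have h := integrable_euclideanCost hμ hν
  have h1 : ∫ x, ∫ y, energyKernel x y ∂ν ∂μ = -∫ x, ∫ y, euclideanCost x y ∂ν ∂μ := by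
    simp only [energyKernel, euclideanCost, integral_neg]
  have h2 : ∫ x, ∫ y, euclideanCost x y ∂ν ∂μ = ∫ p, euclideanCost p.1 p.2 ∂(μ.prod ν) :=
    integral_integral (f := euclideanCost) h
  have h3 : ∫ p, euclideanCost p.1 p.2 ∂(μ.prod ν) =
      (transportCost euclideanCost (μ.prod ν)).toReal :=
    integral_eq_lintegral_of_nonneg_ae (.of_forall fun p ↦ norm_nonneg _) h.aestronglyMeasurable
  rw [h1, h2, h3]

/-- The square root in `mmd` loses nothing, because its argument is nonnegative by the energy
inequality `lintegral_norm_sub_le`. -/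
lemma mmd_energyKernel_sq {P Q : Measure X} [IsProbabilityMeasure P] [IsProbabilityMeasure Q]
    (hP : Integrable (fun x : X ↦ ‖(x : EuclideanSpace ℝ (Fin n))‖) P)
    (hQ : Integrable (fun x : X ↦ ‖(x : EuclideanSpace ℝ (Fin n))‖) Q) :
    mmd energyKernel P Q ^ 2 = 2 * (transportCost euclideanCost (P.prod Q)).toReal -
      (transportCost euclideanCost (P.prod P)).toReal -
      (transportCost euclideanCost (Q.prod Q)).toReal := by
  have hle := lintegral_norm_sub_le P Q (f := fun x : X ↦ (x : EuclideanSpace ℝ (Fin n)))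
    measurable_subtype_coe
  have hprod : ∀ μ ν : Measure X, [IsProbabilityMeasure μ] → [IsProbabilityMeasure ν] →
      ∫⁻ x, ∫⁻ y, ENNReal.ofReal ‖(x : EuclideanSpace ℝ (Fin n)) - y‖ ∂ν ∂μ =
        transportCost euclideanCost (μ.prod ν) := fun μ ν _ _ ↦
    (lintegral_prod _ continuous_euclideanCost.measurable.ennreal_ofReal.aemeasurable).symm
  rw [hprod, hprod, hprod] at hle
  have hPQ := transportCost_euclideanCost_prod_ne_top hP hQ
  have hPP := transportCost_euclideanCost_prod_ne_top hP hP
  have hQQ := transportCost_euclideanCost_prod_ne_top hQ hQ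
  have hreal := ENNReal.toReal_mono (ENNReal.mul_ne_top (by simp) hPQ) hle
  rw [ENNReal.toReal_add hPP hQQ, ENNReal.toReal_mul, ENNReal.toReal_ofNat] at hreal
  rw [mmd, integral_energyKernel hP hP, integral_energyKernel hP hQ, integral_energyKernel hQ hQ,
    Real.sq_sqrt (by linarith)]
  ring

end UnbalancedOT

theorem corollary2p21 {n : ℕ} (X : Set (EuclideanSpace ℝ (Fin n)))
    (P Q : Measure X) [IsProbabilityMeasure P] [IsProbabilityMeasure Q] :
    (∀ d : X → X → ℝ, Continuous (Function.uncurry d) → (∀ x y, 0 ≤ d x y) → (∀ x, d x x = 0) →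
      ∀ η₁ η₂ : ℝ, 0 < η₁ → 0 < η₂ →
        Tendsto (fun lam : ℝ => UnbalancedOT.sinkhornDiv d η₁ η₂ lam P Q) atTop
          (𝓝 (UnbalancedOT.uot d η₁ η₂ P Q).toReal)) ∧
    (Integrable (fun x : X => ‖(x : EuclideanSpace ℝ (Fin n))‖) P →
      Integrable (fun x : X => ‖(x : EuclideanSpace ℝ (Fin n))‖) Q →
      ∃ L : ℝ → ℝ,
        (∀ lam : ℝ, 0 < lam →
          Tendsto (fun η : ℝ × ℝ =>
              UnbalancedOT.sinkhornDiv UnbalancedOT.euclideanCost η.1 η.2 lam P Q)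
            (atTop ×ˢ atTop) (𝓝 (L lam))) ∧
        Tendsto L (𝓝[>] 0) (𝓝 (1 / 2 * UnbalancedOT.mmd UnbalancedOT.energyKernel P Q ^ 2))) := by
  open UnbalancedOT in
  refine ⟨fun d hd _ hd0 η₁ η₂ h₁ h₂ ↦ ?_, fun hP hQ ↦ ?_⟩
  · have lim : ∀ μ ν : Measure X, [IsProbabilityMeasure μ] → [IsProbabilityMeasure ν] →
        Tendsto (fun lam : ℝ ↦ (uotReg d η₁ η₂ lam μ ν).toReal) atTop
          (𝓝 (uot d η₁ η₂ μ ν).toReal) := fun μ ν _ _ ↦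
      (ENNReal.tendsto_toReal (uot_ne_top d η₁ η₂ μ ν)).comp (tendsto_uotReg_atTop μ ν hd h₁ h₂)
    have h := ((lim P Q).sub ((lim P P).const_mul (1 / 2))).sub ((lim Q Q).const_mul (1 / 2))
    simpa [sinkhornDiv, uot_self hd.measurable hd0] using h
  · have hPQ := transportCost_euclideanCost_prod_ne_top hP hQ
    have hPP := transportCost_euclideanCost_prod_ne_top hP hP
    have hQQ := transportCost_euclideanCost_prod_ne_top hQ hQ
    -- the limit of the regularized costs over the marginal parameters
    let S : Measure X → Measure X → ℝ → ℝ := fun μ ν lam ↦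
      (⨆ η : ℝ × ℝ, uotReg euclideanCost η.1 η.2 lam μ ν).toReal
    refine ⟨fun lam ↦ S P Q lam - 1 / 2 * S P P lam - 1 / 2 * S Q Q lam, fun lam _ ↦ ?_, ?_⟩
    · have h := ((tendsto_uotReg_marginal _ lam P Q hPQ).sub
        ((tendsto_uotReg_marginal _ lam P P hPP).const_mul (1 / 2))).sub
        ((tendsto_uotReg_marginal _ lam Q Q hQQ).const_mul (1 / 2))
      simpa [sinkhornDiv] using h
    · have hd := (continuous_euclideanCost (X := X)).measurable
      have hd0 : ∀ x y : X, 0 ≤ euclideanCost x y := fun _ _ ↦ norm_nonneg _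
      have h := ((tendsto_iSup_uotReg hd hd0 P Q hPQ).sub
        ((tendsto_iSup_uotReg hd hd0 P P hPP).const_mul (1 / 2))).sub
        ((tendsto_iSup_uotReg hd hd0 Q Q hQQ).const_mul (1 / 2))
      rw [mmd_energyKernel_sq hP hQ]
      convert h using 2
      ring
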